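/- Let $A$ be a positive-definite real symmetric $n\times n$ matrix and let $\boldsymbol X=(X_1,\ldots,X_n)$ be a random vector with the Gaussian density $\pi^{-n/2}|A|^{1/2}e^{-\boldsymbol x^{\mathsf T}A\boldsymbol x}$, where $|A|=\det A$. Let $\Sigma=(\sigma_{jk})=(2A)^{-1}$ be the corresponding covariance matrix. Let $k\ge 1$, let $\{K_1,\ldots,K_r\}$ be a partition of $\{1,\ldots,k\}$ into $r$ nonempty disjoint blocks, and let $j_1,\ldots,j_k\in\{1,\ldots,n\}$, not necessarily distinct. Here the mixed cumulant of random variables $Z_1,\ldots,Z_r$ ($r\ge1$) whose mixed moments exist is \[ \kappa(Z_1,\ldots,Z_r)=\sum_{\{B_1,\ldots,B_t\}}(-1)^{t+1}(t-1)!\prod_{u=1}^t\mathbb E\Bigl(\prod_{m\in B_u}Z_m\Bigr), \] the sum being over all partitions of $\{1,\ldots,r\}$ into nonempty blocks. Define \[ \kappa=\kappa\Bigl(\prod_{i\in K_1}X_{j_i},\ldots,\prod_{i\in K_r}X_{j_i}\Bigr); \] all the moments in this definition exist. If $k$ is odd, then $\kappa=0$. Suppose that $k$ is even. For a pairing $\pi$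 of $\{1,\ldots,k\}$ (a partition into $k/2$ disjoint unordered pairs), let $G_\pi$ be the graph with vertex set $\{1,\ldots,r\}$ in which distinct $\ell,m$ are adjacent if and only if $\pi$ has a pair $(i_1,i_2)$ with $i_1\in K_\ell$ and $i_2\in K_m$. Let $\varPi$ be the set of all pairings $\pi$ such that $G_\pi$ is connected. Then \[ \kappa=\sum_{\{(i_1,i_2),(i_3,i_4),\ldots,(i_{k-1},i_k)\}\in\varPi}\sigma_{j_{i_1}j_{i_2}}\cdots\sigma_{j_{i_{k-1}}j_{i_k}}. \] -/

import Mathlib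

open MeasureTheory Finset

noncomputable section

/-- The Gaussian density `π^{-n/2} |A|^{1/2} exp(-xᵀ A x)` on `ℝⁿ`. -/
def gaussianDensity {n : ℕ} (A : Matrix (Fin n) (Fin n) ℝ) (x : Fin n → ℝ) : ℝ :=
  Real.pi ^ (-(n : ℝ) / 2) * Real.sqrt A.det * Real.exp (-(x ⬝ᵥ A.mulVec x))

/-- The mixed (joint) cumulant `κ(Z_1, …, Z_r)` of a nonempty finite family of real random
variables all of whose mixed moments exist: the sum of
`(-1)^{t+1} (t-1)! ∏_{u=1}^t E (∏_{m ∈ B_u} Z_m)` over all set partitions `{B_1, …, B_t}` of the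
index set. -/
def mixedCumulant {Ω : Type*} [MeasurableSpace Ω] (P : Measure Ω) {r : ℕ}
    (Z : Fin r → Ω → ℝ) : ℝ :=
  ∑ p : Finpartition (univ : Finset (Fin r)),
    (-1 : ℝ) ^ (p.parts.card + 1) * ((p.parts.card - 1).factorial : ℝ) *
      ∏ B ∈ p.parts, ∫ ω, ∏ m ∈ B, Z m ω ∂P

/-- A pairing of `{1, …, k}`: a partition all of whose parts have exactly two elements. -/
def IsPairing {k : ℕ} (p : Finpartition (univ : Finset (Fin k))) : Prop :=
  ∀ B ∈ p.parts, B.card = 2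

/-- The graph `G_p` on the blocks `K_1, …, K_r`: distinct `l` and `m` are adjacent iff `p` has a
pair with one element in `K_l` and the other in `K_m`. -/
def pairingGraph {k r : ℕ} (K : Fin r → Finset (Fin k))
    (p : Finpartition (univ : Finset (Fin k))) : SimpleGraph (Fin r) where
  Adj l m := l ≠ m ∧ ∃ a ∈ K l, ∃ b ∈ K m, ({a, b} : Finset (Fin k)) ∈ p.parts
  symm := ⟨by
    rintro l m ⟨hlm, a, ha, b, hb, hab⟩
    exact ⟨hlm.symm, b, hb, a, ha, by rwa [Finset.pair_comm]⟩⟩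
  loopless := ⟨fun _ h => h.1 rfl⟩

open Classical in
/-- The set of all pairings of `{1, …, k}` whose graph on the blocks is connected. -/
def connectedPairings {k r : ℕ} (K : Fin r → Finset (Fin k)) :
    Finset (Finpartition (univ : Finset (Fin k))) :=
  univ.filter fun p => IsPairing p ∧ (pairingGraph K p).Connected

/-- The product of `S (j a) (j b)` over all pairs `{a, b}` of `p`, each taken once (written with
`a < b`; the order is immaterial since `S` will be symmetric). -/
def pairingWeight {n k : ℕ} (S : Matrix (Fin n) (Fin n) ℝ) (j : Fin k → Fin n)
    (p : Finpartition (univ : Finset (Fin k))) : ℝ :=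
  ∏ q : Fin k × Fin k with q.1 < q.2 ∧ ({q.1, q.2} : Finset (Fin k)) ∈ p.parts,
    S (j q.1) (j q.2)

end

/-! The proof matches two recursions.

Analytic side: the derivative of `exp (-xᵀAx)` in direction `v` is `-(xᵀ(2A)v) exp (-xᵀAx)`. For `v
= (2A)⁻¹ e` with `e` a basis vector, integration by parts trades one coordinate of a monomial for a
sum over its possible partners, weighted by covariances (`gaussian_moment_insert`). Iterating gives
Wick's formula: a moment is the sum over all pairings of its factors
(`eq_sum_pairings_of_recursion`).

Combinatorial side: let `M S` be the moment of the product over the blocks in `S`. For fixed `a ∈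
S`, `M S` is the sum of `κ(C) M (S \ C)` over all `C` with `a ∈ C ⊆ S` (`sum_formalCumulant_mul`).
Since `M ∅ = 1`, the term `C = S` can be solved for, so the recursion determines the cumulants
(`formalCumulant_eq_of_recursion`). By Wick's formula `M S` is a sum over pairings. Sorting these by
the set `C` of blocks connected to `a` splits each into a connected pairing on `C` and an arbitrary
one on `S \ C`. Hence the connected sums obey the same recursion (`sum_connectedSum_mul`) and equal
the cumulants.

Parity plays no role in this; for odd `k` there are simply no pairings. -/

/-! ### Gaussian integrals and integration by parts -/

/-- A positive-definite quadratic form dominates a positive multiple of the sum of squares. -/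
theorem Matrix.PosDef.exists_pos_mul_sum_sq_le {n : ℕ} {A : Matrix (Fin n) (Fin n) ℝ}
    (hA : A.PosDef) :
    ∃ c : ℝ, 0 < c ∧ ∀ x : Fin n → ℝ, c * ∑ i, x i ^ 2 ≤ x ⬝ᵥ A.mulVec x := by
  -- In dimension 0 the unit sphere is empty and there is no minimum to take.
  rcases subsingleton_or_nontrivial (Fin n → ℝ) with hs | hs
  · refine ⟨1, one_pos, fun x => ?_⟩
    rw [Subsingleton.elim x 0]
    simp
  obtain ⟨y, hy, hmin⟩ := (isCompact_sphere (0 : Fin n → ℝ) 1).exists_isMinOn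
    (NormedSpace.sphere_nonempty.2 zero_le_one)
    (f := fun x : Fin n → ℝ => x ⬝ᵥ A.mulVec x)
    (by simp only [dotProduct, Matrix.mulVec]; fun_prop)
  have hy0 : y ≠ 0 := by
    rintro rfl
    simp at hy
  have hpos : 0 < y ⬝ᵥ A.mulVec y := by simpa using hA.dotProduct_mulVec_pos hy0
  have key : ∀ x : Fin n → ℝ, (y ⬝ᵥ A.mulVec y) * ‖x‖ ^ 2 ≤ x ⬝ᵥ A.mulVec x := by
    intro x
    rcases eq_or_ne x 0 with rfl | hx
    · simp
    have hx' : 0 < ‖x‖ := norm_pos_iff.2 hx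
    have hmem : ‖x‖⁻¹ • x ∈ Metric.sphere (0 : Fin n → ℝ) 1 := by
      simp [norm_smul, hx'.ne']
    have h := hmin hmem
    simp only [Set.mem_ofPred_eq, Matrix.mulVec_smul, dotProduct_smul, smul_dotProduct,
      smul_eq_mul] at h
    calc _ ≤ (‖x‖⁻¹ * (‖x‖⁻¹ * (x ⬝ᵥ A.mulVec x))) * ‖x‖ ^ 2 := by gcongr
      _ = _ := by field_simp
  -- The norm is the sup norm, so the sum of squares is at most `n ‖x‖²`; `n + 1` makes the
  -- denominator visibly positive.
  refine ⟨(y ⬝ᵥ A.mulVec y) / (n + 1), by positivity, fun x => ?_⟩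
  refine le_trans ?_ (key x)
  rw [div_mul_eq_mul_div, mul_div_assoc]
  refine mul_le_mul_of_nonneg_left ?_ hpos.le
  rw [div_le_iff₀ (by positivity)]
  calc ∑ i, x i ^ 2 ≤ ∑ _i : Fin n, ‖x‖ ^ 2 := by
        refine sum_le_sum fun i _ => ?_
        rw [← sq_abs]
        have := norm_le_pi_norm x i
        rw [Real.norm_eq_abs] at this
        gcongr
    _ ≤ ‖x‖ ^ 2 * (n + 1) := by
        simp only [sum_const, card_univ, Fintype.card_fin, nsmul_eq_mul]
        nlinarith [sq_nonneg ‖x‖]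

/-- Monomials are integrable against a Gaussian weight. -/
theorem Matrix.PosDef.integrable_prod_mul_exp_neg {n : ℕ} {A : Matrix (Fin n) (Fin n) ℝ}
    (hA : A.PosDef) {ι : Type*} (S : Finset ι) (j : ι → Fin n) :
    Integrable fun x : Fin n → ℝ =>
      (∏ i ∈ S, x (j i)) * Real.exp (-(x ⬝ᵥ A.mulVec x)) := by
  classical
  obtain ⟨c, hc, hle⟩ := hA.exists_pos_mul_sum_sq_le
  -- The dominating function factors into one-variable Gaussian moments; the exponent of `x a` is
  -- the number of indices that `j` sends to `a`.
  have hint : Integrable fun x : Fin n → ℝ =>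
      ∏ a, (x a ^ (#{i ∈ S | j i = a}) * Real.exp (-c * x a ^ 2)) := by
    refine Integrable.fintype_prod (f := fun (a : Fin n) (t : ℝ) =>
      t ^ (#{i ∈ S | j i = a}) * Real.exp (-c * t ^ 2)) fun a => ?_
    simpa using integrable_rpow_mul_exp_neg_mul_sq hc
      (s := (#{i ∈ S | j i = a} : ℝ)) (neg_one_lt_zero.trans_le (Nat.cast_nonneg _))
  refine hint.mono (Continuous.aestronglyMeasurable ?_) (Filter.Eventually.of_forall fun x => ?_)
  · simp only [dotProduct, Matrix.mulVec]
    fun_prop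
  · rw [prod_mul_distrib, ← Real.exp_sum, norm_mul, norm_mul, Real.norm_of_nonneg (Real.exp_nonneg _),
      Real.norm_of_nonneg (Real.exp_nonneg _)]
    have h1 : ∏ a, x a ^ (#{i ∈ S | j i = a}) = ∏ i ∈ S, x (j i) := by
      rw [← prod_fiberwise S j]
      refine prod_congr rfl fun a _ => ?_
      rw [prod_congr rfl fun i hi => by rw [(mem_filter.1 hi).2], prod_const]
    rw [h1]
    gcongr
    rw [← mul_sum, neg_mul]
    exact neg_le_neg (hle x)

theorem hasLineDerivAt_prod_coord {n : ℕ} {ι : Type*} [DecidableEq ι] (S : Finset ι)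
    (j : ι → Fin n) (x v : Fin n → ℝ) :
    HasLineDerivAt ℝ (fun x : Fin n → ℝ => ∏ i ∈ S, x (j i))
      (∑ i ∈ S, v (j i) * ∏ i' ∈ S.erase i, x (j i')) x v := by
  have h : ∀ i ∈ S, HasDerivAt (fun t : ℝ => x (j i) + t * v (j i)) (v (j i)) 0 := fun i _ => by
    simpa using ((hasDerivAt_id (0 : ℝ)).mul_const (v (j i))).const_add (x (j i))
  have := HasDerivAt.fun_finsetProd h
  simp only [HasLineDerivAt, Pi.add_apply, Pi.smul_apply, smul_eq_mul]
  refine this.congr_deriv (sum_congr rfl fun i _ => ?_)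
  simp [mul_comm]

/-- Symmetry of `A` merges the two cross terms into `2A`; the factor becomes a single coordinate
when `2A` maps `v` to a basis vector. -/
theorem hasLineDerivAt_exp_neg_quadratic {n : ℕ} {A : Matrix (Fin n) (Fin n) ℝ}
    (hA : A.IsSymm) (x v : Fin n → ℝ) :
    HasLineDerivAt ℝ (fun x : Fin n → ℝ => Real.exp (-(x ⬝ᵥ A.mulVec x)))
      (-(x ⬝ᵥ ((2 : ℝ) • A).mulVec v) * Real.exp (-(x ⬝ᵥ A.mulVec x))) x v := by
  have hsymm : v ⬝ᵥ A.mulVec x = x ⬝ᵥ A.mulVec v := by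
    rw [Matrix.dotProduct_mulVec, ← Matrix.mulVec_transpose, hA.eq, dotProduct_comm]
  have hexp : ∀ t : ℝ, (x + t • v) ⬝ᵥ A.mulVec (x + t • v) =
      x ⬝ᵥ A.mulVec x + t * (2 * (x ⬝ᵥ A.mulVec v)) + t ^ 2 * (v ⬝ᵥ A.mulVec v) := fun t => by
    simp only [Matrix.mulVec_add, Matrix.mulVec_smul, dotProduct_add, add_dotProduct,
      smul_dotProduct, dotProduct_smul, smul_eq_mul, hsymm]
    ring
  simp only [HasLineDerivAt, hexp]
  have h := ((((hasDerivAt_id (0 : ℝ)).mul_const (2 * (x ⬝ᵥ A.mulVec v))).const_add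
    (x ⬝ᵥ A.mulVec x)).add (((hasDerivAt_id (0 : ℝ)).pow 2).mul_const (v ⬝ᵥ A.mulVec v))).neg.exp
  refine h.congr_deriv ?_
  simp [Matrix.smul_mulVec]
  ring

/-- Gaussian integration by parts for monomials. -/
theorem Matrix.PosDef.integral_coord_mul_prod_mul_exp {n : ℕ} {A : Matrix (Fin n) (Fin n) ℝ}
    (hA : A.PosDef) {ι : Type*} [DecidableEq ι] (S : Finset ι) (j : ι → Fin n) {a : ι}
    (ha : a ∉ S) :
    ∫ x : Fin n → ℝ, (∏ i ∈ insert a S, x (j i)) * Real.exp (-(x ⬝ᵥ A.mulVec x)) =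
      ∑ i ∈ S, ((2 : ℝ) • A)⁻¹ (j a) (j i) *
        ∫ x : Fin n → ℝ, (∏ i' ∈ S.erase i, x (j i')) * Real.exp (-(x ⬝ᵥ A.mulVec x)) := by
  have hsymm : A.IsSymm := by simpa [Matrix.IsHermitian, Matrix.IsSymm] using hA.isHermitian
  have h2A : ((2 : ℝ) • A).PosDef := hA.smul two_pos
  have h2symm : (((2 : ℝ) • A)⁻¹).IsSymm := by
    simpa [Matrix.IsHermitian, Matrix.IsSymm] using h2A.inv.isHermitian
  have hdet : IsUnit ((2 : ℝ) • A).det := (Matrix.isUnit_iff_isUnit_det _).1 h2A.isUnit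
  -- In this direction the exponential differentiates to `-x (j a)` times itself, and the
  -- coordinates of `v` are the covariances with `j a`.
  set v : Fin n → ℝ := ((2 : ℝ) • A)⁻¹.mulVec (Pi.single (j a) 1) with hv
  have hv' : ((2 : ℝ) • A).mulVec v = Pi.single (j a) 1 := by
    rw [hv, Matrix.mulVec_mulVec, Matrix.mul_nonsing_inv _ hdet, Matrix.one_mulVec]
  have hvi : ∀ b, v b = ((2 : ℝ) • A)⁻¹ (j a) b := fun b => by
    rw [hv, Matrix.mulVec_single_one]
    exact h2symm.apply _ _
  have hI := fun T => hA.integrable_prod_mul_exp_neg (ι := ι) T j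
  have hg' : ∀ x : Fin n → ℝ, HasLineDerivAt ℝ
      (fun x : Fin n → ℝ => Real.exp (-(x ⬝ᵥ A.mulVec x)))
      (-(x (j a)) * Real.exp (-(x ⬝ᵥ A.mulVec x))) x v := fun x => by
    simpa [hv'] using hasLineDerivAt_exp_neg_quadratic hsymm x v
  have hins : ∀ x : Fin n → ℝ, (∏ i ∈ S, x (j i)) *
      (-(x (j a)) * Real.exp (-(x ⬝ᵥ A.mulVec x))) =
      -((∏ i ∈ insert a S, x (j i)) * Real.exp (-(x ⬝ᵥ A.mulVec x))) := fun x => by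
    rw [prod_insert ha]
    ring
  have hsum : ∀ x : Fin n → ℝ, (∑ i ∈ S, v (j i) * ∏ i' ∈ S.erase i, x (j i')) *
      Real.exp (-(x ⬝ᵥ A.mulVec x)) = ∑ i ∈ S, v (j i) *
        ((∏ i' ∈ S.erase i, x (j i')) * Real.exp (-(x ⬝ᵥ A.mulVec x))) := fun x => by
    rw [sum_mul]
    exact sum_congr rfl fun i _ => mul_assoc _ _ _
  have key := integral_bilinear_hasLineDerivAt_right_eq_neg_left_of_integrable
    (μ := (volume : Measure (Fin n → ℝ))) (B := ContinuousLinearMap.mul ℝ ℝ) (v := v)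
    (f := fun x : Fin n → ℝ => ∏ i ∈ S, x (j i))
    (g := fun x : Fin n → ℝ => Real.exp (-(x ⬝ᵥ A.mulVec x)))
    (f' := fun x => ∑ i ∈ S, v (j i) * ∏ i' ∈ S.erase i, x (j i'))
    (g' := fun x => -(x (j a)) * Real.exp (-(x ⬝ᵥ A.mulVec x)))
    (by
      simp only [ContinuousLinearMap.mul_apply', hsum]
      exact integrable_finsetSum _ fun i _ => (hI _).const_mul _)
    (by
      simp only [ContinuousLinearMap.mul_apply', hins]
      exact (hI _).neg)
    (hI S) (fun x _ => hasLineDerivAt_prod_coord S j x v) (fun x _ => hg' x)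
  simp only [ContinuousLinearMap.mul_apply', hsum, hins] at key
  rw [integral_neg, neg_inj] at key
  rw [key, integral_finsetSum _ fun i _ => (hI _).const_mul _]
  simp only [integral_const_mul, hvi]

/-! ### Moments of the Gaussian vector -/

section Moments

variable {Ω : Type*} [MeasurableSpace Ω] {P : Measure Ω} {n : ℕ} {A : Matrix (Fin n) (Fin n) ℝ}
  {X : Ω → Fin n → ℝ}

theorem measurable_gaussianDensity (A : Matrix (Fin n) (Fin n) ℝ) :
    Measurable (gaussianDensity A) := by
  refine Continuous.measurable ?_
  unfold gaussianDensity
  simp only [dotProduct, Matrix.mulVec]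
  fun_prop

theorem gaussianDensity_nonneg (A : Matrix (Fin n) (Fin n) ℝ) (x : Fin n → ℝ) :
    0 ≤ gaussianDensity A x := by
  unfold gaussianDensity
  have := Real.pi_pos
  positivity

theorem integrable_prod_of_map_eq_gaussian (hA : A.PosDef) (hX : AEMeasurable X P)
    (hdens : P.map X = volume.withDensity fun x => ENNReal.ofReal (gaussianDensity A x))
    {ι : Type*} (S : Finset ι) (j : ι → Fin n) : Integrable (fun ω => ∏ i ∈ S, X ω (j i)) P := by
  have h : Integrable (fun x : Fin n → ℝ => ∏ i ∈ S, x (j i)) (P.map X) := by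
    rw [hdens, integrable_withDensity_iff (measurable_gaussianDensity A).ennreal_ofReal
      (Filter.Eventually.of_forall fun _ => ENNReal.ofReal_lt_top)]
    have := (hA.integrable_prod_mul_exp_neg S j).const_mul
      (Real.pi ^ (-(n : ℝ) / 2) * Real.sqrt A.det)
    refine this.congr (Filter.Eventually.of_forall fun x => ?_)
    dsimp only
    rw [ENNReal.toReal_ofReal (gaussianDensity_nonneg A x), gaussianDensity]
    ring
  exact h.comp_aemeasurable hX

theorem integral_prod_of_map_eq_gaussian (hX : AEMeasurable X P)
    (hdens : P.map X = volume.withDensity fun x => ENNReal.ofReal (gaussianDensity A x))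
    {ι : Type*} (S : Finset ι) (j : ι → Fin n) :
    ∫ ω, ∏ i ∈ S, X ω (j i) ∂P = (Real.pi ^ (-(n : ℝ) / 2) * Real.sqrt A.det) *
      ∫ x : Fin n → ℝ, (∏ i ∈ S, x (j i)) * Real.exp (-(x ⬝ᵥ A.mulVec x)) := by
  have h := integral_map (f := fun x : Fin n → ℝ => ∏ i ∈ S, x (j i)) hX
    (Continuous.aestronglyMeasurable (by fun_prop))
  rw [← h, hdens, integral_withDensity_eq_integral_toReal_smul
    (measurable_gaussianDensity A).ennreal_ofReal
    (Filter.Eventually.of_forall fun _ => ENNReal.ofReal_lt_top), ← integral_const_mul]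
  refine integral_congr_ae (Filter.Eventually.of_forall fun x => ?_)
  dsimp only
  rw [ENNReal.toReal_ofReal (gaussianDensity_nonneg A x), gaussianDensity, smul_eq_mul]
  ring

/-- The recursion for the moments of a centred Gaussian vector. -/
theorem gaussian_moment_insert (hA : A.PosDef) (hX : AEMeasurable X P)
    (hdens : P.map X = volume.withDensity fun x => ENNReal.ofReal (gaussianDensity A x))
    {ι : Type*} [DecidableEq ι] (S : Finset ι) (j : ι → Fin n) {a : ι} (ha : a ∉ S) :
    ∫ ω, ∏ i ∈ insert a S, X ω (j i) ∂P =
      ∑ i ∈ S, ((2 : ℝ) • A)⁻¹ (j a) (j i) * ∫ ω, ∏ i' ∈ S.erase i, X ω (j i') ∂P := by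
  simp only [integral_prod_of_map_eq_gaussian hX hdens,
    hA.integral_coord_mul_prod_mul_exp S j ha, mul_sum]
  exact sum_congr rfl fun i _ => by ring

end Moments

/-! ### Set partitions and the moment-cumulant recursion -/

section SetPartitions

variable {α : Type*} [DecidableEq α]

/-- `Q` is the set of blocks of a partition of `S`. -/
structure IsSetPartition (Q : Finset (Finset α)) (S : Finset α) : Prop where
  nonempty : ∀ B ∈ Q, B.Nonempty
  subset : ∀ B ∈ Q, B ⊆ S
  cover : ∀ x ∈ S, ∃ B ∈ Q, x ∈ B
  unique : ∀ B ∈ Q, ∀ B' ∈ Q, ∀ x ∈ B, x ∈ B' → B = B'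

theorem Finpartition.isSetPartition {S : Finset α} (p : Finpartition S) :
    IsSetPartition p.parts S where
  nonempty _ hB := p.nonempty_of_mem_parts hB
  subset _ hB := p.subset hB
  cover _ hx := p.exists_mem hx
  unique _ hB _ hB' _ hx hx' := p.eq_of_mem_parts hB hB' hx hx'

theorem IsSetPartition.exists_finpartition {S : Finset α} {Q : Finset (Finset α)}
    (h : IsSetPartition Q S) : ∃ p : Finpartition S, p.parts = Q := by
  refine ⟨⟨Q, ?_, ?_, ?_⟩, rfl⟩
  · rw [Finset.supIndep_iff_pairwiseDisjoint]
    intro B hB B' hB' hne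
    refine Finset.disjoint_left.2 fun x hx hx' => hne (h.unique B hB B' hB' x hx hx')
  · ext x
    simp only [Finset.mem_sup, id]
    exact ⟨fun ⟨B, hB, hx⟩ => h.subset B hB hx, h.cover x⟩
  · intro h0
    exact Finset.not_nonempty_empty (h.nonempty _ h0)

theorem IsSetPartition.union {Q₁ Q₂ : Finset (Finset α)} {S₁ S₂ : Finset α}
    (h₁ : IsSetPartition Q₁ S₁) (h₂ : IsSetPartition Q₂ S₂) (hd : Disjoint S₁ S₂) :
    IsSetPartition (Q₁ ∪ Q₂) (S₁ ∪ S₂) where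
  nonempty B hB := (mem_union.1 hB).elim (h₁.nonempty B) (h₂.nonempty B)
  subset B hB := (mem_union.1 hB).elim (fun h => (h₁.subset B h).trans subset_union_left)
    (fun h => (h₂.subset B h).trans subset_union_right)
  cover x hx := by
    rcases mem_union.1 hx with hx | hx
    · obtain ⟨B, hB, hxB⟩ := h₁.cover x hx
      exact ⟨B, mem_union_left _ hB, hxB⟩
    · obtain ⟨B, hB, hxB⟩ := h₂.cover x hx
      exact ⟨B, mem_union_right _ hB, hxB⟩
  unique B hB B' hB' x hx hx' := by
    rcases mem_union.1 hB with hB | hB <;> rcases mem_union.1 hB' with hB' | hB'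
    · exact h₁.unique B hB B' hB' x hx hx'
    · exact absurd (h₂.subset B' hB' hx') (Finset.disjoint_left.1 hd (h₁.subset B hB hx))
    · exact absurd (h₂.subset B hB hx) (Finset.disjoint_left.1 hd (h₁.subset B' hB' hx'))
    · exact h₂.unique B hB B' hB' x hx hx'

omit [DecidableEq α] in
theorem IsSetPartition.singleton {S : Finset α} (h : S.Nonempty) : IsSetPartition {S} S where
  nonempty B hB := by rwa [mem_singleton.1 hB]
  subset B hB := by rw [mem_singleton.1 hB]
  cover x hx := ⟨S, mem_singleton_self S, hx⟩
  unique B hB B' hB' _ _ _ := by rw [mem_singleton.1 hB, mem_singleton.1 hB']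

omit [DecidableEq α] in
/-- A union of blocks is partitioned by these blocks. -/
theorem IsSetPartition.of_subset {Q Q' : Finset (Finset α)} {S T : Finset α}
    (h : IsSetPartition Q S) (hQ : Q' ⊆ Q) (hsub : ∀ B ∈ Q', B ⊆ T)
    (hcov : ∀ x ∈ T, ∃ B ∈ Q', x ∈ B) : IsSetPartition Q' T where
  nonempty B hB := h.nonempty B (hQ hB)
  subset := hsub
  cover := hcov
  unique B hB B' hB' := h.unique B (hQ hB) B' (hQ hB')

theorem IsSetPartition.erase {Q : Finset (Finset α)} {S D : Finset α}
    (h : IsSetPartition Q S) (hD : D ∈ Q) : IsSetPartition (Q.erase D) (S \ D) := by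
  refine h.of_subset (erase_subset _ _) (fun B hB x hx => ?_) fun x hx => ?_
  · refine mem_sdiff.2 ⟨h.subset B (mem_of_mem_erase hB) hx, fun hxD => ?_⟩
    exact ne_of_mem_erase hB (h.unique B (mem_of_mem_erase hB) D hD x hx hxD)
  · obtain ⟨hxS, hxD⟩ := mem_sdiff.1 hx
    obtain ⟨B, hB, hxB⟩ := h.cover x hxS
    exact ⟨B, mem_erase.2 ⟨fun h => hxD (h ▸ hxB), hB⟩, hxB⟩

open Classical in
/-- All partitions of `S` into nonempty blocks. -/
noncomputable def setPartitions (S : Finset α) : Finset (Finset (Finset α)) :=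
  S.powerset.powerset.filter fun Q => IsSetPartition Q S

omit [DecidableEq α] in
theorem mem_setPartitions {S : Finset α} {Q : Finset (Finset α)} :
    Q ∈ setPartitions S ↔ IsSetPartition Q S := by
  simp only [setPartitions, mem_filter, mem_powerset, and_iff_right_iff_imp]
  exact fun h B hB => mem_powerset.2 (h.subset B hB)

theorem sum_finpartition_eq_sum_setPartitions {M : Type*} [AddCommMonoid M] (S : Finset α)
    (f : Finset (Finset α) → M) :
    ∑ p : Finpartition S, f p.parts = ∑ Q ∈ setPartitions S, f Q := by
  refine sum_bij (fun p _ => p.parts) (fun p _ => mem_setPartitions.2 p.isSetPartition)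
    (fun p _ q _ h => Finpartition.ext h) (fun Q hQ => ?_) fun _ _ => rfl
  obtain ⟨p, hp⟩ := (mem_setPartitions.1 hQ).exists_finpartition
  exact ⟨p, mem_univ _, hp⟩

/-- The formal cumulant of `S` built from the formal moments `M`. -/
noncomputable def formalCumulant (M : Finset α → ℝ) (S : Finset α) : ℝ :=
  ∑ Q ∈ setPartitions S, (-1 : ℝ) ^ (#Q + 1) * ((#Q - 1).factorial : ℝ) * ∏ B ∈ Q, M B

/-- A proper subset `C` containing `a` with a partition of `C` amounts to a partition of `S` with a
marked block avoiding `a`: adjoin `S \ C` as the marked block. This raises the number of blocks by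
one, which shifts the sign and the factorial. -/
theorem sum_formalCumulant_ssubset_mul (M : Finset α → ℝ) {S : Finset α} {a : α} (ha : a ∈ S) :
    ∑ C ∈ S.powerset.filter (fun C => a ∈ C ∧ C ≠ S), formalCumulant M C * M (S \ C) =
      ∑ Q ∈ setPartitions S, ∑ _D ∈ Q.filter (fun D => a ∉ D),
        (-1 : ℝ) ^ #Q * ((#Q - 2).factorial : ℝ) * ∏ B ∈ Q, M B := by
  simp only [formalCumulant, sum_mul]
  rw [sum_sigma', sum_sigma']
  refine sum_bij' (fun x _ => ⟨insert (S \ x.1) x.2, S \ x.1⟩)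
    (fun y _ => ⟨S \ y.2, y.1.erase y.2⟩) ?_ ?_ ?_ ?_ ?_
  · rintro ⟨C, Q⟩ h
    simp only [mem_sigma, mem_filter, mem_powerset, mem_setPartitions] at h ⊢
    obtain ⟨⟨hCS, haC, hne⟩, hQ⟩ := h
    have hn : (S \ C).Nonempty := by
      rw [sdiff_nonempty]
      exact fun hSC => hne (hCS.antisymm hSC)
    refine ⟨?_, mem_insert_self _ _, fun h => (mem_sdiff.1 h).2 haC⟩
    have := (IsSetPartition.singleton hn).union hQ disjoint_sdiff_self_left
    rwa [sdiff_union_of_subset hCS, ← insert_eq] at this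
  · rintro ⟨Q, D⟩ h
    simp only [mem_sigma, mem_filter, mem_powerset, mem_setPartitions] at h ⊢
    obtain ⟨hQ, hD, haD⟩ := h
    refine ⟨⟨sdiff_subset, mem_sdiff.2 ⟨ha, haD⟩, fun h => ?_⟩, hQ.erase hD⟩
    obtain ⟨x, hx⟩ := hQ.nonempty D hD
    have hxS := hQ.subset D hD hx
    rw [← h] at hxS
    exact (mem_sdiff.1 hxS).2 hx
  · rintro ⟨C, Q⟩ h
    simp only [mem_sigma, mem_filter, mem_powerset, mem_setPartitions] at h
    obtain ⟨⟨hCS, haC, hne⟩, hQ⟩ := h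
    have hnot : S \ C ∉ Q := fun hm => by
      obtain ⟨x, hx⟩ := hQ.nonempty _ hm
      exact (mem_sdiff.1 hx).2 (hQ.subset _ hm hx)
    simp only [Finset.sdiff_sdiff_eq_self hCS, erase_insert hnot]
  · rintro ⟨Q, D⟩ h
    simp only [mem_sigma, mem_filter, mem_setPartitions] at h
    obtain ⟨hQ, hD, haD⟩ := h
    simp only [Finset.sdiff_sdiff_eq_self (hQ.subset D hD), insert_erase hD]
  · rintro ⟨C, Q⟩ h
    simp only [mem_sigma, mem_filter, mem_powerset, mem_setPartitions] at h
    obtain ⟨⟨hCS, haC, hne⟩, hQ⟩ := h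
    have hnot : S \ C ∉ Q := fun hm => by
      obtain ⟨x, hx⟩ := hQ.nonempty _ hm
      exact (mem_sdiff.1 hx).2 (hQ.subset _ hm hx)
    simp only [card_insert_of_notMem hnot, prod_insert hnot]
    rw [show #Q + 1 - 2 = #Q - 1 by omega]
    ring

/-- The recursion expressing moments by cumulants. -/
theorem sum_formalCumulant_mul (M : Finset α → ℝ) (hM : M ∅ = 1) {S : Finset α} {a : α}
    (ha : a ∈ S) :
    ∑ C ∈ S.powerset.filter (fun C => a ∈ C), formalCumulant M C * M (S \ C) = M S := by
  have hsplit : S.powerset.filter (fun C => a ∈ C) =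
      insert S (S.powerset.filter fun C => a ∈ C ∧ C ≠ S) := by
    ext C
    simp only [mem_filter, mem_powerset, mem_insert]
    constructor
    · rintro ⟨h, h'⟩
      tauto
    · rintro (rfl | h)
      · exact ⟨subset_rfl, ha⟩
      · exact ⟨h.1, h.2.1⟩
  rw [hsplit, sum_insert (by simp), sum_formalCumulant_ssubset_mul M ha, sdiff_self, bot_eq_empty,
    hM, mul_one, formalCumulant, ← sum_add_distrib]
  -- A partition with `t ≥ 2` blocks has `t - 1` blocks avoiding `a`, and `(t - 1) (t - 2)! = (t -
  -- 1)!` with opposite sign cancels its own term. Only the one-block partition survives.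
  rw [sum_eq_single {S}]
  · simp [ha]
  · intro Q hQ hne
    have hQ := mem_setPartitions.1 hQ
    obtain ⟨B₀, hB₀, haB₀⟩ := hQ.cover a ha
    have hfil : Q.filter (fun D => a ∉ D) = Q.erase B₀ := by
      ext D
      simp only [mem_filter, mem_erase]
      constructor
      · rintro ⟨hD, haD⟩
        exact ⟨fun h => haD (h ▸ haB₀), hD⟩
      · rintro ⟨hD, hDQ⟩
        exact ⟨hDQ, fun haD => hD (hQ.unique D hDQ B₀ hB₀ a haD haB₀)⟩
    have hcard : 2 ≤ #Q := by
      by_contra! hlt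
      have h1 : #Q = 1 := by
        have := card_pos.2 ⟨B₀, hB₀⟩
        omega
      obtain ⟨B, rfl⟩ := card_eq_one.1 h1
      refine hne ?_
      congr 1
      refine (hQ.subset B (mem_singleton_self B)).antisymm fun x hx => ?_
      obtain ⟨B', hB', hxB'⟩ := hQ.cover x hx
      rwa [mem_singleton.1 hB'] at hxB'
    rw [hfil, sum_const, card_erase_of_mem hB₀, nsmul_eq_mul]
    obtain ⟨t, ht⟩ := Nat.exists_eq_add_of_le hcard
    rw [ht, show 2 + t - 1 = t + 1 by omega, show 2 + t - 2 = t by omega, Nat.factorial_succ]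
    push_cast
    ring
  · intro h
    exact absurd (mem_setPartitions.2 (IsSetPartition.singleton ⟨a, ha⟩)) h

/-- The cumulants are determined by the moments through the recursion over the set that contains
a given point. -/
theorem formalCumulant_eq_of_recursion (M : Finset α → ℝ) (hM : M ∅ = 1)
    (c : α → Finset α → ℝ)
    (hc : ∀ S a, a ∈ S →
      ∑ C ∈ S.powerset.filter (fun C => a ∈ C), c a C * M (S \ C) = M S)
    {S : Finset α} {a : α} (ha : a ∈ S) : formalCumulant M S = c a S := by
  induction S using Finset.strongInduction with
  | H S ih =>
    have h := (sum_formalCumulant_mul M hM ha).trans (hc S a ha).symm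
    have hS : S ∈ S.powerset.filter (fun C => a ∈ C) := by simp [ha]
    rw [← add_sum_erase _ _ hS, ← add_sum_erase _ _ hS] at h
    have hrest : ∑ C ∈ (S.powerset.filter (fun C => a ∈ C)).erase S,
        formalCumulant M C * M (S \ C) =
        ∑ C ∈ (S.powerset.filter (fun C => a ∈ C)).erase S, c a C * M (S \ C) := by
      refine sum_congr rfl fun C hC => ?_
      simp only [mem_erase, mem_filter, mem_powerset] at hC
      rw [ih C (hC.2.1.ssubset_of_ne hC.1) hC.2.2]
    rw [hrest] at h
    simpa [hM] using add_right_cancel h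

end SetPartitions

/-! ### Pairings and Wick's formula -/

section Pairings

variable {β : Type*} [DecidableEq β]

/-- The pairings of a finite set, as sets of unordered pairs. -/
noncomputable def pairings (U : Finset β) : Finset (Finset (Finset β)) :=
  (setPartitions U).filter fun Q => ∀ B ∈ Q, #B = 2

omit [DecidableEq β] in
theorem mem_pairings {U : Finset β} {Q : Finset (Finset β)} :
    Q ∈ pairings U ↔ IsSetPartition Q U ∧ ∀ B ∈ Q, #B = 2 := by
  simp only [pairings, mem_filter, mem_setPartitions]

omit [DecidableEq β] in
theorem pairings_empty : pairings (∅ : Finset β) = {∅} := by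
  ext Q
  simp only [mem_pairings, mem_singleton]
  constructor
  · rintro ⟨h, -⟩
    refine eq_empty_of_forall_notMem fun B hB => ?_
    obtain ⟨x, hx⟩ := h.nonempty B hB
    exact notMem_empty x (h.subset B hB hx)
  · rintro rfl
    exact ⟨⟨by simp, by simp, by simp, by simp⟩, by simp⟩

theorem insert_pair_mem_pairings {S : Finset β} {a i : β} (ha : a ∉ S) (hi : i ∈ S)
    {Q : Finset (Finset β)} (hQ : Q ∈ pairings (S.erase i)) :
    insert {a, i} Q ∈ pairings (insert a S) := by
  have hai : a ≠ i := fun h => ha (h ▸ hi)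
  obtain ⟨hQ, h2⟩ := mem_pairings.1 hQ
  refine mem_pairings.2 ⟨?_, fun B hB => ?_⟩
  · have := (IsSetPartition.singleton (insert_nonempty a {i})).union hQ
      (by simp [Finset.disjoint_left, ha])
    rwa [← insert_eq, insert_union, ← insert_eq, insert_erase hi] at this
  · rcases mem_insert.1 hB with rfl | hB
    · exact card_pair hai
    · exact h2 B hB

/-- The sum over all pairings, sorted by the partner of a given point. -/
theorem sum_pairings_insert (s : Finset β → ℝ) {S : Finset β} {a : β} (ha : a ∉ S) :
    ∑ Q ∈ pairings (insert a S), ∏ B ∈ Q, s B =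
      ∑ i ∈ S, s {a, i} * ∑ Q ∈ pairings (S.erase i), ∏ B ∈ Q, s B := by
  simp only [mul_sum]
  rw [sum_sigma']
  have hnot : ∀ i ∈ S, ∀ T ⊆ S, ∀ Q ∈ pairings T, ({a, i} : Finset β) ∉ Q := fun i hi T hT Q hQ hm =>
    ha (hT ((mem_pairings.1 hQ).1.subset _ hm (mem_insert_self a _)))
  symm
  refine sum_bij (fun x _ => insert {a, x.1} x.2) ?_ ?_ ?_ ?_
  · rintro ⟨i, Q⟩ h
    obtain ⟨hi, hQ⟩ := mem_sigma.1 h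
    exact insert_pair_mem_pairings ha hi hQ
  · rintro ⟨i, Q⟩ h ⟨i', Q'⟩ h' heq
    obtain ⟨hi, hQ⟩ := mem_sigma.1 h
    obtain ⟨hi', hQ'⟩ := mem_sigma.1 h'
    dsimp only at hi hQ hi' hQ' heq
    have hmem : ({a, i} : Finset β) ∈ insert {a, i'} Q' := heq ▸ mem_insert_self _ _
    have hpair : ({a, i} : Finset β) = {a, i'} :=
      (mem_insert.1 hmem).resolve_right (hnot i hi _ (erase_subset _ _) Q' hQ')
    have hii : i = i' := by
      have : i ∈ ({a, i'} : Finset β) := hpair ▸ mem_insert_of_mem (mem_singleton_self i)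
      rcases mem_insert.1 this with h | h
      · exact absurd (h ▸ hi) ha
      · exact mem_singleton.1 h
    subst hii
    rw [← erase_insert (hnot i hi _ (erase_subset _ _) Q hQ), heq,
      erase_insert (hnot i hi _ (erase_subset _ _) Q' hQ')]
  · intro Q hQ
    obtain ⟨hQ, h2⟩ := mem_pairings.1 hQ
    obtain ⟨B, hB, haB⟩ := hQ.cover a (mem_insert_self a S)
    obtain ⟨i, hi⟩ := card_eq_one.1 (by rw [card_erase_of_mem haB, h2 B hB] : #(B.erase a) = 1)
    have hBi : B = {a, i} := by rw [← insert_erase haB, hi]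
    have hia : i ∈ B.erase a := hi ▸ mem_singleton_self i
    have hiS : i ∈ S := (mem_insert.1 (hQ.subset B hB (mem_of_mem_erase hia))).resolve_left
      (ne_of_mem_erase hia)
    refine ⟨⟨i, Q.erase B⟩, mem_sigma.2 ⟨hiS, mem_pairings.2 ⟨?_, fun B' hB' =>
      h2 B' (mem_of_mem_erase hB')⟩⟩, ?_⟩
    · have := hQ.erase hB
      rwa [hBi, show insert a S \ {a, i} = S.erase i by
        ext x
        simp only [mem_sdiff, mem_insert, mem_singleton, mem_erase]
        constructor
        · tauto
        · rintro ⟨h1, h2⟩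
          exact ⟨Or.inr h2, fun h => h.elim (fun h => ha (h ▸ h2)) h1⟩, ← hBi] at this
    · dsimp only
      rw [← hBi, insert_erase hB]
  · rintro ⟨i, Q⟩ h
    obtain ⟨hi, hQ⟩ := mem_sigma.1 h
    rw [prod_insert (hnot i hi _ (erase_subset _ _) Q hQ)]

/-- A set function that obeys the pair recursion is a sum over pairings. -/
theorem eq_sum_pairings_of_recursion (E : Finset β → ℝ) (s : Finset β → ℝ) (h0 : E ∅ = 1)
    (hrec : ∀ (S : Finset β) (a : β), a ∉ S → E (insert a S) = ∑ i ∈ S, s {a, i} * E (S.erase i))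
    (U : Finset β) : E U = ∑ Q ∈ pairings U, ∏ B ∈ Q, s B := by
  induction U using Finset.strongInduction with
  | H U ih =>
    rcases U.eq_empty_or_nonempty with rfl | ⟨a, ha⟩
    · simp [h0, pairings_empty]
    · have hnot := notMem_erase a U
      rw [← insert_erase ha, hrec _ _ hnot, sum_pairings_insert s hnot]
      refine sum_congr rfl fun i hi => ?_
      rw [ih _ (((erase_subset i _).trans_ssubset (erase_ssubset ha)))]

theorem even_card_of_mem_pairings {U : Finset β} {Q : Finset (Finset β)} (hQ : Q ∈ pairings U) :
    Even #U := by
  obtain ⟨hQ, h2⟩ := mem_pairings.1 hQ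
  obtain ⟨p, rfl⟩ := hQ.exists_finpartition
  rw [← p.sum_card_parts, sum_congr rfl h2]
  simp

end Pairings

/-! ### Splitting a pairing at the component of a block -/

section Components

variable {α β : Type*} [DecidableEq α] [DecidableEq β]

/-- `Q` contains a pair that joins the blocks `K l` and `K m`. -/
noncomputable def Linked (K : α → Finset β) (Q : Finset (Finset β)) (l m : α) : Prop :=
  ∃ x ∈ K l, ∃ y ∈ K m, ({x, y} : Finset β) ∈ Q

omit [DecidableEq α] in
theorem Linked.mono {K : α → Finset β} {Q Q' : Finset (Finset β)} (h : Q ⊆ Q') {l m : α} :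
    Linked K Q l m → Linked K Q' l m :=
  fun ⟨x, hx, y, hy, hQ⟩ => ⟨x, hx, y, hy, h hQ⟩

open Classical in
/-- The sum over the pairings of the blocks in `C` that join all these blocks to `a`. -/
noncomputable def connectedSum (K : α → Finset β) (s : Finset β → ℝ) (a : α) (C : Finset α) : ℝ :=
  ∑ Q ∈ (pairings (C.biUnion K)).filter
    (fun Q => ∀ l ∈ C, Relation.ReflTransGen (Linked K Q) a l), ∏ B ∈ Q, s B

variable {K : α → Finset β}

theorem mem_biUnion_iff_of_disjoint (hdisj : Pairwise fun l m => Disjoint (K l) (K m))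
    {T : Finset α} {x : β} {l : α} (hx : x ∈ K l) : x ∈ T.biUnion K ↔ l ∈ T := by
  refine ⟨fun h => ?_, fun h => mem_biUnion.2 ⟨l, h, hx⟩⟩
  obtain ⟨m, hm, hxm⟩ := mem_biUnion.1 h
  by_contra hl
  have hne : l ≠ m := fun h => hl (h ▸ hm)
  exact Finset.disjoint_left.1 (hdisj hne) hx hxm

/-- If every pair of `Q` that meets the blocks in `C` stays in them, then paths that start in `C`
only use pairs inside the blocks in `C`. -/
theorem reflTransGen_linked_of_closed (hdisj : Pairwise fun l m => Disjoint (K l) (K m))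
    {Q Q' : Finset (Finset β)} {C : Finset α} {a : α} (ha : a ∈ C)
    (hQ : ∀ B ∈ Q, ∀ x ∈ B, x ∈ C.biUnion K → B ⊆ C.biUnion K ∧ B ∈ Q') {l : α}
    (h : Relation.ReflTransGen (Linked K Q) a l) :
    l ∈ C ∧ Relation.ReflTransGen (Linked K Q') a l := by
  induction h with
  | refl => exact ⟨ha, .refl⟩
  | tail _ hlm ih =>
    obtain ⟨x, hx, y, hy, hxy⟩ := hlm
    have hB := hQ _ hxy x (mem_insert_self _ _) ((mem_biUnion_iff_of_disjoint hdisj hx).2 ih.1)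
    exact ⟨(mem_biUnion_iff_of_disjoint hdisj hy).1
      (hB.1 (mem_insert_of_mem (mem_singleton_self y))), ih.2.tail ⟨x, hx, y, hy, hB.2⟩⟩

open Classical in
-- No pair crosses between a component and its complement, so restriction to the two sides is a
-- bijection onto pairs (connected pairing on `C`, arbitrary pairing on `S \ C`), and the weight is
-- multiplicative.
theorem sum_pairings_component_eq (hdisj : Pairwise fun l m => Disjoint (K l) (K m))
    (s : Finset β → ℝ) {S C : Finset α} {a : α} (hCS : C ⊆ S) (ha : a ∈ C) :
    ∑ Q ∈ (pairings (S.biUnion K)).filter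
      (fun Q => S.filter (fun l => Relation.ReflTransGen (Linked K Q) a l) = C), ∏ B ∈ Q, s B =
    connectedSum K s a C * ∑ Q ∈ pairings ((S \ C).biUnion K), ∏ B ∈ Q, s B := by
  have hdU : Disjoint (C.biUnion K) ((S \ C).biUnion K) := by
    refine Finset.disjoint_left.2 fun x hx hx' => ?_
    obtain ⟨l, hl, hxl⟩ := mem_biUnion.1 hx
    exact (mem_sdiff.1 ((mem_biUnion_iff_of_disjoint hdisj hxl).1 hx')).2 hl
  have hU : C.biUnion K ∪ (S \ C).biUnion K = S.biUnion K := by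
    rw [← union_biUnion, union_sdiff_of_subset hCS]
  have hnotboth : ∀ B : Finset β, B.Nonempty → B ⊆ C.biUnion K → ¬ B ⊆ (S \ C).biUnion K :=
    fun B ⟨x, hx⟩ h h' => Finset.disjoint_left.1 hdU (h hx) (h' hx)
  -- A pair with one end over `C` would carry reachability from `a` to the block of its other end.
  have hdich : ∀ Q ∈ (pairings (S.biUnion K)).filter
      (fun Q => S.filter (fun l => Relation.ReflTransGen (Linked K Q) a l) = C),
      ∀ B ∈ Q, B ⊆ C.biUnion K ∨ B ⊆ (S \ C).biUnion K := by
    intro Q hQ B hB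
    obtain ⟨hQ, hC⟩ := mem_filter.1 hQ
    obtain ⟨hQ, h2⟩ := mem_pairings.1 hQ
    obtain ⟨x, y, -, rfl⟩ := card_eq_two.1 (h2 B hB)
    obtain ⟨l, hl, hxl⟩ := mem_biUnion.1 (hQ.subset _ hB (mem_insert_self x _))
    obtain ⟨m, hm, hym⟩ := mem_biUnion.1
      (hQ.subset _ hB (mem_insert_of_mem (mem_singleton_self y)))
    have hstep : ∀ l' m', Linked K Q l' m' → m' ∈ S → l' ∈ C → m' ∈ C := by
      intro l' m' hlink hm' hl'
      rw [← hC] at hl' ⊢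
      exact mem_filter.2 ⟨hm', (mem_filter.1 hl').2.tail hlink⟩
    have hlm : l ∈ C ↔ m ∈ C := ⟨hstep l m ⟨x, hxl, y, hym, hB⟩ hm,
      hstep m l ⟨y, hym, x, hxl, by rwa [pair_comm]⟩ hl⟩
    by_cases hlC : l ∈ C
    · left
      simp only [insert_subset_iff, singleton_subset_iff]
      exact ⟨mem_biUnion.2 ⟨l, hlC, hxl⟩, mem_biUnion.2 ⟨m, hlm.1 hlC, hym⟩⟩
    · right
      simp only [insert_subset_iff, singleton_subset_iff]
      exact ⟨mem_biUnion.2 ⟨l, mem_sdiff.2 ⟨hl, hlC⟩, hxl⟩,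
        mem_biUnion.2 ⟨m, mem_sdiff.2 ⟨hm, fun h => hlC (hlm.2 h)⟩, hym⟩⟩
  have hunion : ∀ Q ∈ (pairings (S.biUnion K)).filter
      (fun Q => S.filter (fun l => Relation.ReflTransGen (Linked K Q) a l) = C),
      Q.filter (· ⊆ C.biUnion K) ∪ Q.filter (· ⊆ (S \ C).biUnion K) = Q := by
    intro Q hQ
    rw [← filter_or]
    exact filter_true_of_mem (hdich Q hQ)
  rw [connectedSum, sum_mul_sum, ← sum_product']
  refine sum_bij' (fun Q _ => (Q.filter (· ⊆ C.biUnion K), Q.filter (· ⊆ (S \ C).biUnion K)))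
    (fun q _ => q.1 ∪ q.2) ?_ ?_ hunion ?_ ?_
  · intro Q hQ'
    have hd := hdich Q hQ'
    obtain ⟨hQ, hC⟩ := mem_filter.1 hQ'
    obtain ⟨hQ, h2⟩ := mem_pairings.1 hQ
    have hin : ∀ B ∈ Q, ∀ x ∈ B, x ∈ C.biUnion K → B ⊆ C.biUnion K := fun B hB x hx hxC =>
      (hd B hB).resolve_right fun h => Finset.disjoint_left.1 hdU hxC (h hx)
    have hout : ∀ B ∈ Q, ∀ x ∈ B, x ∈ (S \ C).biUnion K → B ⊆ (S \ C).biUnion K :=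
      fun B hB x hx hxC => (hd B hB).resolve_left fun h => Finset.disjoint_left.1 hdU (h hx) hxC
    have hsub : ∀ T ⊆ S, (∀ B ∈ Q, ∀ x ∈ B, x ∈ T.biUnion K → B ⊆ T.biUnion K) →
        Q.filter (· ⊆ T.biUnion K) ∈ pairings (T.biUnion K) := by
      intro T hT hcl
      refine mem_pairings.2 ⟨hQ.of_subset (filter_subset _ _) (fun B hB => (mem_filter.1 hB).2)
        fun x hx => ?_, fun B hB => h2 B (mem_filter.1 hB).1⟩
      obtain ⟨B, hB, hxB⟩ := hQ.cover x (biUnion_subset_biUnion_of_subset_left K hT hx)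
      exact ⟨B, mem_filter.2 ⟨hB, hcl B hB x hxB hx⟩, hxB⟩
    refine mem_product.2 ⟨mem_filter.2 ⟨hsub C hCS hin, fun l hl => ?_⟩,
      hsub (S \ C) sdiff_subset hout⟩
    have hR : Relation.ReflTransGen (Linked K Q) a l := by
      rw [← hC] at hl
      exact (mem_filter.1 hl).2
    exact (reflTransGen_linked_of_closed hdisj ha (fun B hB x hx hxC =>
      ⟨hin B hB x hx hxC, mem_filter.2 ⟨hB, hin B hB x hx hxC⟩⟩) hR).2
  · rintro ⟨Q₁, Q₂⟩ h
    obtain ⟨h₁, h₂⟩ := mem_product.1 h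
    obtain ⟨h₁, hconn⟩ := mem_filter.1 h₁
    obtain ⟨h₁, hc₁⟩ := mem_pairings.1 h₁
    obtain ⟨h₂, hc₂⟩ := mem_pairings.1 h₂
    refine mem_filter.2 ⟨mem_pairings.2 ⟨?_, fun B hB => ?_⟩, ?_⟩
    · have := h₁.union h₂ hdU
      rwa [hU] at this
    · exact (mem_union.1 hB).elim (hc₁ B) (hc₂ B)
    · ext l
      simp only [mem_filter]
      constructor
      · rintro ⟨-, hR⟩
        -- Pairs of `Q₂` never meet the blocks in `C`, so a path from `a` cannot leave `C`.
        refine (reflTransGen_linked_of_closed hdisj ha (Q' := Q₁) (fun B hB x hx hxC => ?_) hR).1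
        rcases mem_union.1 hB with hB | hB
        · exact ⟨h₁.subset B hB, hB⟩
        · exact absurd (h₂.subset B hB hx) (Finset.disjoint_left.1 hdU hxC)
      · intro hl
        exact ⟨hCS hl, Relation.ReflTransGen.mono (fun _ _ => Linked.mono subset_union_left) _ _ (hconn l hl)⟩
  · rintro ⟨Q₁, Q₂⟩ h
    obtain ⟨h₁, h₂⟩ := mem_product.1 h
    have h₁ := (mem_pairings.1 (mem_filter.1 h₁).1).1
    have h₂ := (mem_pairings.1 h₂).1
    dsimp only at h₁ h₂ ⊢
    rw [filter_union, filter_union, filter_true_of_mem h₁.subset, filter_true_of_mem h₂.subset,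
      filter_false_of_mem fun B hB hBC => hnotboth B (h₂.nonempty B hB) hBC (h₂.subset B hB),
      filter_false_of_mem fun B hB => hnotboth B (h₁.nonempty B hB) (h₁.subset B hB),
      union_empty, empty_union]
  · intro Q hQ
    dsimp only
    rw [← prod_union, hunion Q hQ]
    refine disjoint_filter.2 fun B hB => hnotboth B ?_
    exact (mem_pairings.1 (mem_filter.1 hQ).1).1.nonempty B hB

/-- Every pairing is counted once, at the set of blocks reachable from `a`. -/
theorem sum_connectedSum_mul (hdisj : Pairwise fun l m => Disjoint (K l) (K m))
    (s : Finset β → ℝ) {S : Finset α} {a : α} (ha : a ∈ S) :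
    ∑ C ∈ S.powerset.filter (fun C => a ∈ C),
      connectedSum K s a C * ∑ Q ∈ pairings ((S \ C).biUnion K), ∏ B ∈ Q, s B =
    ∑ Q ∈ pairings (S.biUnion K), ∏ B ∈ Q, s B := by
  classical
  rw [← sum_fiberwise_of_maps_to (s := pairings (S.biUnion K))
    (t := S.powerset.filter (fun C => a ∈ C))
    (g := fun Q => S.filter (fun l => Relation.ReflTransGen (Linked K Q) a l))]
  · refine sum_congr rfl fun C hC => ?_
    obtain ⟨hCS, haC⟩ := mem_filter.1 hC
    exact (sum_pairings_component_eq hdisj s (mem_powerset.1 hCS) haC).symm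
  · intro Q _
    exact mem_filter.2 ⟨mem_powerset.2 (filter_subset _ _), mem_filter.2 ⟨ha, .refl⟩⟩

end Components

/-! ### Translation to the graph, weights and cumulant of the statement -/

/-- `Linked` may relate a block to itself, unlike graph adjacency; such loops do not affect the
reflexive-transitive closure. -/
theorem pairingGraph_reachable_iff {k r : ℕ} (K : Fin r → Finset (Fin k))
    (p : Finpartition (univ : Finset (Fin k))) (a l : Fin r) :
    (pairingGraph K p).Reachable a l ↔ Relation.ReflTransGen (Linked K p.parts) a l := by
  rw [SimpleGraph.reachable_iff_reflTransGen]
  constructor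
  · exact Relation.ReflTransGen.mono (fun _ _ h => h.2) _ _
  · intro h
    induction h with
    | refl => exact .refl
    | @tail l m _ hlm ih =>
      by_cases hne : l = m
      · exact hne ▸ ih
      · exact ih.tail ⟨hne, hlm⟩

theorem pairingGraph_connected_iff {k r : ℕ} (K : Fin r → Finset (Fin k))
    (p : Finpartition (univ : Finset (Fin k))) (a : Fin r) :
    (pairingGraph K p).Connected ↔ ∀ l, Relation.ReflTransGen (Linked K p.parts) a l := by
  simp only [← pairingGraph_reachable_iff]
  refine ⟨fun h l => h.preconnected a l, fun h => ?_⟩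
  have : Nonempty (Fin r) := ⟨a⟩
  exact ⟨fun l m => (h l).symm.trans (h m)⟩

/-- The weight of an unordered pair, read off from its increasing enumeration. -/
noncomputable def pairWeight {n k : ℕ} (S : Matrix (Fin n) (Fin n) ℝ) (j : Fin k → Fin n)
    (B : Finset (Fin k)) : ℝ :=
  ∏ q : Fin k × Fin k with q.1 < q.2 ∧ ({q.1, q.2} : Finset (Fin k)) = B, S (j q.1) (j q.2)

theorem pairWeight_pair_of_lt {n k : ℕ} (S : Matrix (Fin n) (Fin n) ℝ) (j : Fin k → Fin n)
    {a b : Fin k} (hab : a < b) : pairWeight S j {a, b} = S (j a) (j b) := by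
  have : (univ.filter fun q : Fin k × Fin k =>
      q.1 < q.2 ∧ ({q.1, q.2} : Finset (Fin k)) = {a, b}) = {(a, b)} := by
    ext ⟨x, y⟩
    simp only [mem_filter, mem_univ, true_and, mem_singleton, Prod.mk.injEq]
    constructor
    · rintro ⟨hxy, h⟩
      have hx : x ∈ ({a, b} : Finset (Fin k)) := h ▸ mem_insert_self x _
      have hy : y ∈ ({a, b} : Finset (Fin k)) :=
        h ▸ mem_insert_of_mem (mem_singleton_self y)
      simp only [mem_insert, mem_singleton] at hx hy
      omega
    · rintro ⟨rfl, rfl⟩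
      exact ⟨hab, rfl⟩
  rw [pairWeight, this, prod_singleton]

theorem pairWeight_pair {n k : ℕ} {S : Matrix (Fin n) (Fin n) ℝ} (hS : S.IsSymm)
    (j : Fin k → Fin n) {a b : Fin k} (hab : a ≠ b) :
    pairWeight S j {a, b} = S (j a) (j b) := by
  rcases hab.lt_or_gt with h | h
  · exact pairWeight_pair_of_lt S j h
  · rw [pair_comm, pairWeight_pair_of_lt S j h, hS.apply]

theorem pairingWeight_eq_prod_pairWeight {n k : ℕ} (S : Matrix (Fin n) (Fin n) ℝ)
    (j : Fin k → Fin n) (p : Finpartition (univ : Finset (Fin k))) :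
    pairingWeight S j p = ∏ B ∈ p.parts, pairWeight S j B := by
  rw [pairingWeight, ← prod_fiberwise_of_maps_to (t := p.parts)
    (g := fun q : Fin k × Fin k => ({q.1, q.2} : Finset (Fin k)))
    fun q hq => (mem_filter.1 hq).2.2]
  refine prod_congr rfl fun B hB => prod_congr ?_ fun _ _ => rfl
  ext q
  simp only [mem_filter, mem_univ, true_and]
  constructor
  · rintro ⟨⟨h1, -⟩, h2⟩
    exact ⟨h1, h2⟩
  · rintro ⟨h1, h2⟩
    exact ⟨⟨h1, h2 ▸ hB⟩, h2⟩

theorem sum_connectedPairings_eq_connectedSum {n k r : ℕ} (S : Matrix (Fin n) (Fin n) ℝ)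
    (j : Fin k → Fin n) (K : Fin r → Finset (Fin k)) (hcover : ∀ i, ∃ l, i ∈ K l) (a : Fin r) :
    ∑ p ∈ connectedPairings K, pairingWeight S j p =
      connectedSum K (pairWeight S j) a univ := by
  classical
  have hU : (univ : Finset (Fin r)).biUnion K = univ := by
    ext i
    simpa using hcover i
  rw [connectedSum, hU, pairings, filter_filter, sum_filter, connectedPairings, sum_filter,
    ← sum_finpartition_eq_sum_setPartitions]
  refine sum_congr rfl fun p _ => ?_
  simp only [pairingWeight_eq_prod_pairWeight, pairingGraph_connected_iff K p a, IsPairing,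
    mem_univ, true_implies]

theorem mixedCumulant_eq_formalCumulant {Ω : Type*} [MeasurableSpace Ω] (P : Measure Ω) {r : ℕ}
    (Z : Fin r → Ω → ℝ) :
    mixedCumulant P Z = formalCumulant (fun B => ∫ ω, ∏ m ∈ B, Z m ω ∂P) univ :=
  sum_finpartition_eq_sum_setPartitions univ fun Q =>
    (-1 : ℝ) ^ (#Q + 1) * ((#Q - 1).factorial : ℝ) * ∏ B ∈ Q, ∫ ω, ∏ m ∈ B, Z m ω ∂P

theorem theorem2p2 {Ω : Type*} [MeasurableSpace Ω] (P : Measure Ω) [IsProbabilityMeasure P]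
    {n : ℕ} (A : Matrix (Fin n) (Fin n) ℝ) (hA : A.PosDef)
    (X : Ω → Fin n → ℝ) (hX : AEMeasurable X P)
    (hdens : P.map X = volume.withDensity fun x => ENNReal.ofReal (gaussianDensity A x))
    {k r : ℕ} (hk : 1 ≤ k) (j : Fin k → Fin n)
    (K : Fin r → Finset (Fin k)) (hne : ∀ l, (K l).Nonempty)
    (hdisj : Pairwise fun l m => Disjoint (K l) (K m))
    (hcover : ∀ i, ∃ l, i ∈ K l) :
    -- all the moments that enter the cumulant exist
    (∀ B : Finset (Fin r), Integrable (fun ω => ∏ l ∈ B, ∏ i ∈ K l, X ω (j i)) P) ∧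
    (Odd k → mixedCumulant P (fun l ω => ∏ i ∈ K l, X ω (j i)) = 0) ∧
    (Even k → mixedCumulant P (fun l ω => ∏ i ∈ K l, X ω (j i)) =
      ∑ p ∈ connectedPairings K, pairingWeight ((2 : ℝ) • A)⁻¹ j p) := by
  have hprod : ∀ (B : Finset (Fin r)) (ω : Ω),
      ∏ l ∈ B, ∏ i ∈ K l, X ω (j i) = ∏ i ∈ B.biUnion K, X ω (j i) := fun B ω =>
    (prod_biUnion fun l _ m _ hlm => hdisj hlm).symm
  have hsymm : (((2 : ℝ) • A)⁻¹).IsSymm := by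
    simpa [Matrix.IsHermitian, Matrix.IsSymm] using (hA.smul two_pos).inv.isHermitian
  set s := pairWeight ((2 : ℝ) • A)⁻¹ j with hs
  have hwick : ∀ U : Finset (Fin k),
      ∫ ω, ∏ i ∈ U, X ω (j i) ∂P = ∑ Q ∈ pairings U, ∏ B ∈ Q, s B := by
    -- The empty moment is 1 because `P` is a probability measure; the Gaussian normalising integral
    -- is never computed.
    refine eq_sum_pairings_of_recursion _ s (by simp) fun S a ha => ?_
    rw [gaussian_moment_insert hA hX hdens S j ha]
    refine sum_congr rfl fun i hi => ?_
    have hai : a ≠ i := fun h => ha (h ▸ hi)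
    rw [hs, pairWeight_pair hsymm j hai]
  -- Since `k ≥ 1` there is at least one block, needed as base point for the recursion.
  obtain ⟨a, -⟩ := hcover ⟨0, hk⟩
  have hκ : mixedCumulant P (fun l ω => ∏ i ∈ K l, X ω (j i)) =
      ∑ p ∈ connectedPairings K, pairingWeight ((2 : ℝ) • A)⁻¹ j p := by
    rw [mixedCumulant_eq_formalCumulant, sum_connectedPairings_eq_connectedSum _ j K hcover a]
    simp only [hprod, hwick]
    exact formalCumulant_eq_of_recursion
      (fun B => ∑ Q ∈ pairings (B.biUnion K), ∏ B' ∈ Q, s B') (by simp [pairings_empty])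
      (connectedSum K s) (fun S b hb => sum_connectedSum_mul hdisj s hb) (mem_univ a)
  refine ⟨fun B => ?_, fun hodd => ?_, fun _ => hκ⟩
  · simp only [hprod]
    exact integrable_prod_of_map_eq_gaussian hA hX hdens _ j
  · rw [hκ]
    refine sum_eq_zero fun p hp => ?_
    have h2 : IsPairing p := by
      classical
      exact (mem_filter.1 hp).2.1
    have heven := even_card_of_mem_pairings (mem_pairings.2 ⟨p.isSetPartition, h2⟩)
    rw [card_univ, Fintype.card_fin] at heven
    exact absurd heven (Nat.not_even_iff_odd.2 hodd)
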